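/- Let a finite group $G$ act from the right on a field $L$, $(y,\tau)\mapsto y^\tau$, by field automorphisms, and let $K=\mathrm{Fix}_G L$ be the fixed field. Let $N$ be the kernel of the operation map $G\to\mathrm{Aut}(L)$, and put $g=|G|$, $n=|N|$, $h=[L:K]$, so that $g=nh$. Assume that $n$ is invertible in $K$. The twisted group ring $L\wr G$ is the free right $L$-module with basis $G$, endowed with the multiplication determined by $(\sigma y)(\tau z)=(\sigma\tau)(y^\tau z)$ for $\sigma,\tau\in G$, $y,z\in L$; it is a $K$-algebra. Let $(-,=)$ be the $K$-bilinear form on $L\wr G$ determined by $$(\sigma y,\tau z)=\delta_{\sigma,\tau^{-1}}\,\mathrm{Tr}_{L/K}(y^\tau z).$$ Let $\{X_i : i\in I\}$, $I$ finite, be a complete set of pairwise nonisomorphic simple right $L\wr G$-modules. For $i\in I$ let $K_i=\mathrm{End}_{L\wr G}X_i$, a skew field acting on $X_i$ from the left, let $x_i=\dim_{K_i}X_i$, and let $d_i\ge 1$ be defined by $d_i^2=[K_i:Z(K_i)]$, where $Z(K_i)$ is the center of $K_i$. Let $\omega_i:L\wr G\to\mathrm{End}_{K_i}X_i$ be the operation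 of $L\wr G$ on $X_i$, where elements of $\mathrm{End}_{K_i}X_i$ are written on the right and composed from left to right. Let $\mathrm{tr}_{K_i/K}=\mathrm{Tr}_{Z(K_i)/K}\circ\mathrm{tr}_{K_i/Z(K_i)}:K_i\to K$, where $\mathrm{tr}_{K_i/Z(K_i)}$ is the reduced trace. For $\phi\in\mathrm{End}_{K_i}X_i$ let $\mathrm{Tr}_{K_i}\phi\in K_i$ be the sum of the diagonal entries of the matrix of $\phi$ with respect to a $K_i$-basis of $X_i$. Then $x_i$ and $[K_i:Z(K_i)]$ are finite, the latter is a square (so that $d_i$ is an integer), and $x_id_i/h$ is an integer for all $i\in I$. Moreover, for every choice of the $K_i$-bases of the modules $X_i$ and for all $\xi,\eta\in L\wr G$, $$(\xi,\eta)=\sum_{i\in I}\frac{x_id_i}{g}\cdot\mathrm{tr}_{K_i/K}\,\mathrm{Tr}_{K_i}\bigl((\xi\omega_i)(\eta\omega_i)\bigr),$$ where $\frac{x_id_i}{g}\in K$ stands for $\frac1n\cdot\frac{x_id_i}{h}$, the quotient of the integer $x_id_i/h$ by $n$ in $K$. -/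

import Mathlib

open scoped TensorProduct

/-! ### Twisted group rings

A group `G` acts on a commutative ring `C` from the right, `(y, τ) ↦ y ^ τ`; this is an action of
`Gᵐᵒᵖ` in Mathlib, with `y ^ τ = MulOpposite.op τ • y`. -/

/-- The twisted group ring `C ≀ G`: the free right `C`-module on `G` with the multiplication
`(σ y) (τ z) = (σ τ) (y ^ τ z)`, see `TwistedGroupRing.single_mul_single`. In Mathlib's
`SkewMonoidAlgebra C Gᵐᵒᵖ` the product of `τ` (with coefficient `z`) and `σ` (with coefficient `y`)
is `σ τ` with coefficient `z (y ^ τ)`, so that `C ≀ G` is the opposite ring. -/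
def TwistedGroupRing (C : Type*) (G : Type*) [CommRing C] [Group G]
    [MulSemiringAction Gᵐᵒᵖ C] : Type _ :=
  (SkewMonoidAlgebra C Gᵐᵒᵖ)ᵐᵒᵖ

namespace TwistedGroupRing

section Basic

variable {C : Type*} {G : Type*} [CommRing C] [Group G] [MulSemiringAction Gᵐᵒᵖ C]

noncomputable instance : Ring (TwistedGroupRing C G) :=
  inferInstanceAs (Ring (SkewMonoidAlgebra C Gᵐᵒᵖ)ᵐᵒᵖ)

noncomputable instance {B : Type*} [CommRing B] [Algebra B C] [SMulCommClass Gᵐᵒᵖ B C] :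
    Algebra B (TwistedGroupRing C G) :=
  inferInstanceAs (Algebra B (SkewMonoidAlgebra C Gᵐᵒᵖ)ᵐᵒᵖ)

variable (C G) in
/-- The twisted group ring in terms of Mathlib's skew monoid algebra. -/
noncomputable def equivSkewMonoidAlgebra : TwistedGroupRing C G ≃+* (SkewMonoidAlgebra C Gᵐᵒᵖ)ᵐᵒᵖ :=
  RingEquiv.refl _

/-- The element `σ y` of `C ≀ G`. -/
noncomputable def single (σ : G) (y : C) : TwistedGroupRing C G :=
  (equivSkewMonoidAlgebra C G).symm
    (MulOpposite.op (SkewMonoidAlgebra.single (MulOpposite.op σ) y))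

/-- The coefficient `y_σ` of `ξ = ∑ σ y_σ`. -/
noncomputable def coeff (ξ : TwistedGroupRing C G) (σ : G) : C :=
  (MulOpposite.unop (equivSkewMonoidAlgebra C G ξ)).coeff (MulOpposite.op σ)

theorem single_mul_single (σ τ : G) (y z : C) :
    single σ y * single τ z = single (σ * τ) (MulOpposite.op τ • y * z) := by
  simp only [single, ← map_mul, ← MulOpposite.op_mul, SkewMonoidAlgebra.single_mul_single,
    mul_comm]

theorem coeff_single [DecidableEq G] (σ τ : G) (y : C) :
    coeff (single σ y) τ = if σ = τ then y else 0 := by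
  classical
  simp [coeff, single, SkewMonoidAlgebra.coeff_single, Finsupp.single_apply]

theorem coeff_add (ξ η : TwistedGroupRing C G) (σ : G) :
    coeff (ξ + η) σ = coeff ξ σ + coeff η σ := by
  simp [coeff]

theorem coeff_smul {B : Type*} [CommRing B] [Algebra B C] [SMulCommClass Gᵐᵒᵖ B C]
    (c : B) (ξ : TwistedGroupRing C G) (σ : G) : coeff (c • ξ) σ = c • coeff ξ σ :=
  rfl

theorem algebraMap_eq_single {B : Type*} [CommRing B] [Algebra B C] [SMulCommClass Gᵐᵒᵖ B C]
    (c : B) : algebraMap B (TwistedGroupRing C G) c = single 1 (algebraMap B C c) :=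
  rfl

end Basic

section Form

variable (L : Type*) (G : Type*) [Field L] [Group G] [MulSemiringAction Gᵐᵒᵖ L]

/-- The fixed field `K = Fix_G L`. -/
abbrev fixedField : Subfield L := FixedPoints.subfield Gᵐᵒᵖ L

/-- The kernel `N` of the operation of `G` on `L`. -/
def actionKernel : Subgroup G where
  carrier := {σ | ∀ y : L, MulOpposite.op σ • y = y}
  one_mem' y := by simp
  mul_mem' {σ τ} hσ hτ y := by rw [MulOpposite.op_mul, mul_smul, hσ y, hτ y]
  inv_mem' {σ} hσ y := by
    rw [MulOpposite.op_inv, inv_smul_eq_iff]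
    exact (hσ y).symm

/-- The `K`-bilinear form on `L ≀ G` with `(σ y, τ z) = δ_{σ, τ⁻¹} Tr_{L/K} (y ^ τ z)`,
see `TwistedGroupRing.form_single_single`. -/
noncomputable def form [Fintype G] :
    LinearMap.BilinForm (fixedField L G) (TwistedGroupRing L G) :=
  LinearMap.mk₂ (fixedField L G)
    (fun ξ η => ∑ τ : G, Algebra.trace (fixedField L G) L
      (MulOpposite.op τ • coeff ξ τ⁻¹ * coeff η τ))
    (fun ξ ξ' η => by
      simp only [coeff_add, smul_add, add_mul, map_add, Finset.sum_add_distrib])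
    (fun c ξ η => by
      simp only [coeff_smul, smul_comm _ c, smul_mul_assoc, map_smul, Finset.smul_sum])
    (fun ξ η η' => by
      simp only [coeff_add, mul_add, map_add, Finset.sum_add_distrib])
    (fun c ξ η => by
      simp only [coeff_smul, mul_smul_comm, map_smul, Finset.smul_sum])

theorem form_apply [Fintype G] (ξ η : TwistedGroupRing L G) :
    form L G ξ η = ∑ τ : G, Algebra.trace (fixedField L G) L
      (MulOpposite.op τ • coeff ξ τ⁻¹ * coeff η τ) :=
  rfl

theorem form_single_single [Fintype G] [DecidableEq G] (σ τ : G) (y z : L) :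
    form L G (single σ y) (single τ z) =
      if σ = τ⁻¹ then Algebra.trace (fixedField L G) L (MulOpposite.op τ • y * z) else 0 := by
  simp only [form_apply, coeff_single]
  rw [Finset.sum_eq_single τ (fun ρ _ h => by simp [Ne.symm h]) (by simp)]
  by_cases h : σ = τ⁻¹ <;> simp [h]

end Form

end TwistedGroupRing

/-! ### Reduced traces -/

/-- `c` is the reduced trace of the element `a` of the central simple `F`-algebra `A`: after
extension of scalars to an algebraic closure, `A` becomes a matrix algebra, in which the trace of
`a` is `c`. -/
def IsReducedTrace (F : Type*) {A : Type*} [Field F] [Ring A] [Algebra F A] (a : A) (c : F) :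
    Prop :=
  ∃ (m : ℕ) (e : AlgebraicClosure F ⊗[F] A ≃ₐ[AlgebraicClosure F]
      Matrix (Fin m) (Fin m) (AlgebraicClosure F)),
    (e (1 ⊗ₜ[F] a)).trace = algebraMap F (AlgebraicClosure F) c

open Classical in
/-- The reduced trace `A → F` of a central simple `F`-algebra `A`. -/
noncomputable def reducedTrace (F : Type*) {A : Type*} [Field F] [Ring A] [Algebra F A] (a : A) :
    F :=
  if h : ∃ c : F, IsReducedTrace F a c then h.choose else 0

/-- For a skew field `D` over `K` with center `Z`, the map `tr_{D/K} = Tr_{Z/K} ∘ tr_{D/Z}`, where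
`tr_{D/Z}` is the reduced trace. -/
noncomputable def skewFieldTrace (K : Type*) {D : Type*} [Field K] [DivisionRing D] [Algebra K D]
    (w : D) : K :=
  Algebra.trace K (Subalgebra.center K D)
    ⟨(reducedTrace (Subring.center D) w : D), (reducedTrace (Subring.center D) w).2⟩

/-- The number `d` with `d ^ 2 = [D : Z(D)]`. -/
noncomputable def skewFieldIndex (D : Type*) [Ring D] : ℕ :=
  Nat.sqrt (Module.finrank (Subring.center D) D)

/-! ### Simple modules

A right module over `A` is a (left) module over `Aᵐᵒᵖ` in Mathlib, with `x ξ = MulOpposite.op ξ • x`.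
Its endomorphism ring `Module.End Aᵐᵒᵖ X` acts on `X` from the left. -/

section RightModule

variable (A : Type*) [Ring A] (X : Type*) [AddCommGroup X] [Module Aᵐᵒᵖ X]

/-- The operation `ω : A → End_D X` of `A` on the right `A`-module `X`, where `D = End_A X`. As
`D` acts from the left, the elements of `End_D X` are written on the right and are composed from
left to right: this is the opposite of Mathlib's multiplication. -/
noncomputable def rightOperation : A →+* (Module.End (Module.End Aᵐᵒᵖ X) X)ᵐᵒᵖ where
  toFun ξ := MulOpposite.op (Module.toModuleEnd (Module.End Aᵐᵒᵖ X) X (MulOpposite.op ξ))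
  map_one' := by rw [MulOpposite.op_one, map_one, MulOpposite.op_one]
  map_mul' ξ η := by rw [MulOpposite.op_mul, map_mul, MulOpposite.op_mul]
  map_zero' := by rw [MulOpposite.op_zero, map_zero, MulOpposite.op_zero]
  map_add' ξ η := by rw [MulOpposite.op_add, map_add, MulOpposite.op_add]

theorem rightOperation_apply (ξ : A) (x : X) :
    (rightOperation A X ξ).unop x = MulOpposite.op ξ • x := rfl

open Classical in
/-- The map `tr_{D/K} : D → K` for the endomorphism skew field `D = End_A X` of a simple right
`A`-module `X`, where `A` is a `K`-algebra. -/
noncomputable def endTrace (K : Type*) [Field K] [Algebra K A] [Module K X]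
    [IsScalarTower K Aᵐᵒᵖ X] [IsSimpleModule Aᵐᵒᵖ X] (w : Module.End Aᵐᵒᵖ X) : K :=
  skewFieldTrace K w

end RightModule

/-- The trace `Tr_D φ = ∑ a, φ_{a,a}` in `D` of an endomorphism `φ` (written on the right) of a left
`D`-module, with respect to the basis `b`. -/
noncomputable def matrixTrace {D X ι : Type*} [Ring D] [AddCommGroup X] [Module D X] [Fintype ι]
    (b : Module.Basis ι D X) (φ : (Module.End D X)ᵐᵒᵖ) : D :=
  ∑ a, b.repr (φ.unop (b a)) a

universe u v w

/-! ### Traces of linear maps -/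

namespace LinearMap

/-! The form depends only on the product: `(ξ, η) = λ (ξ η)` with `λ ξ = Tr_{L/K} (coeff ξ 1)`. To
expand `λ` over the simple modules, the trace of the `K`-linear map `a ↦ y a ξ` on `L ≀ G`, with `y`
in `L`, is computed twice. In the basis `G` it is `n * Tr y * λ ξ` (`trace_mulLeftMulRight`). On a
Wedderburn block it is `Tr_{Z_i/K}` of the product of the reduced traces of `y` and `ξ`
(`trace_mulLeftMulRight_matrix_divisionRing`).

Conjugation by `G` induces the whole Galois group on `L`, so every embedding of `L` occurs equally
often in the split block. Hence `y` has reduced trace `r_i * Tr y` with `x_i d_i = r_i h`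
(`exists_trace_splitMatrix_eq`), which also gives the integrality. Taking `Tr y = 1` and dividing by
`n` yields the formula.

The same trace formula kills the Jacobson radical: nilpotent elements have trace zero and the form
is nondegenerate (`jacobson_op_eq_bot`). With the density theorem this gives the Wedderburn
decomposition. Nondegeneracy also forces `r_i ≠ 0` in `Z_i`, whence the reduced traces take values
in the center. -/

theorem trace_pi {R ι : Type*} [Fintype ι] [DecidableEq ι] [CommRing R] {M : ι → Type*}
    [∀ i, AddCommGroup (M i)] [∀ i, Module R (M i)] [∀ i, Module.Free R (M i)]
    [∀ i, Module.Finite R (M i)] (f : (∀ i, M i) →ₗ[R] (∀ i, M i)) :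
    trace R _ f = ∑ i, trace R (M i) (proj i ∘ₗ f ∘ₗ single R M i) := by
  classical
  let b : ∀ i, Module.Basis _ R (M i) := fun i => Module.Free.chooseBasis R (M i)
  rw [trace_eq_matrix_trace R (Pi.basis b), Matrix.trace, Fintype.sum_sigma]
  refine Finset.sum_congr rfl fun i _ => ?_
  rw [trace_eq_matrix_trace R (b i), Matrix.trace]
  refine Finset.sum_congr rfl fun k _ => ?_
  simp [Matrix.diag, LinearMap.toMatrix_apply, Pi.basis_repr]

/-- Transitivity of the trace. -/
theorem trace_trace_restrictScalars (R : Type*) {S M : Type*} [CommRing R] [CommRing S]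
    [Algebra R S] [AddCommGroup M] [Module R M] [Module S M] [IsScalarTower R S M]
    [Module.Free R S] [Module.Finite R S] [Module.Free S M] [Module.Finite S M]
    (f : M →ₗ[S] M) :
    trace R M (f.restrictScalars R) = Algebra.trace R S (trace S M f) := by
  classical
  let b := Module.Free.chooseBasis R S
  let c := Module.Free.chooseBasis S M
  rw [trace_eq_matrix_trace R (b.smulTower c), trace_eq_matrix_trace S c, Matrix.trace,
    Matrix.trace, ← Finset.univ_product_univ, Finset.sum_product, Finset.sum_comm, map_sum]
  refine Finset.sum_congr rfl fun i _ => ?_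
  rw [Algebra.trace_eq_matrix_trace b, Matrix.trace]
  refine Finset.sum_congr rfl fun k _ => ?_
  simp [Matrix.diag, LinearMap.toMatrix_apply, Algebra.leftMulMatrix_eq_repr_mul,
    Module.Basis.smulTower_repr, mul_comm]

variable {F D : Type*} [Field F] [Ring D] [Algebra F D]

/-- The map `a ↦ u a v`. -/
abbrev mulLeftMulRight (F : Type*) {D : Type*} [CommRing F] [Ring D] [Algebra F D] (u v : D) :
    D →ₗ[F] D :=
  mulLeft F u ∘ₗ mulRight F v

theorem trace_mulLeftMulRight_pi {ι : Type*} [Fintype ι] {S : ι → Type*} [∀ i, Ring (S i)]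
    [∀ i, Algebra F (S i)] [∀ i, FiniteDimensional F (S i)] (u v : ∀ i, S i) :
    trace F _ (mulLeftMulRight F u v) = ∑ i, trace F _ (mulLeftMulRight F (u i) (v i)) := by
  classical
  rw [trace_pi]
  refine Finset.sum_congr rfl fun i _ => congrArg _ (LinearMap.ext fun a => ?_)
  simp

/-- The map sends the matrix unit at `(k, l)` with entry `a` to a matrix with `(k, l)` entry `u k k
* a * v l l`, so only the diagonals of `u` and `v` matter. -/
theorem trace_mulLeftMulRight_matrix [FiniteDimensional F D] {ι : Type*} [Fintype ι]
    [DecidableEq ι] (u v : Matrix ι ι D) :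
    trace F _ (mulLeftMulRight F u v) =
      ∑ k, ∑ l, trace F D (mulLeftMulRight F (u k k) (v l l)) := by
  let e : Matrix ι ι D ≃ₗ[F] (ι → ι → D) := (Matrix.ofLinearEquiv F).symm
  let f : (ι → ι → D) →ₗ[F] (ι → ι → D) := e.conj (mulLeftMulRight F u v)
  rw [← trace_conj' (mulLeftMulRight F u v) e]
  change trace F (ι → ι → D) f = _
  rw [trace_pi]
  refine Finset.sum_congr rfl fun k _ => ?_
  rw [trace_pi]
  refine Finset.sum_congr rfl fun l _ => congrArg _ (LinearMap.ext fun a => ?_)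
  have h2 : (single F (fun _ : ι => ι → D) k (single F (fun _ : ι => D) l a) : ι → ι → D) =
      Matrix.single k l a := by
    ext i j
    by_cases hi : k = i
    · subst hi
      by_cases hj : l = j
      · subst hj; simp
      · simp [hj, Ne.symm hj]
    · simp [hi, Ne.symm hi]
  change f (single F (fun _ : ι => ι → D) k (single F (fun _ : ι => D) l a)) k l =
    u k k * (a * v l l)
  rw [h2]
  change (u * (Matrix.single k l a * v)) k l = _
  rw [Matrix.mul_apply, Finset.sum_eq_single k, Matrix.single_mul_apply_same]
  · intro j _ hj
    rw [Matrix.single_mul_apply_of_ne _ _ _ _ _ hj, mul_zero]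
  · simp

theorem trace_mulLeftMulRight_field_matrix {ι : Type*} [Fintype ι] [DecidableEq ι]
    (u v : Matrix ι ι F) : trace F _ (mulLeftMulRight F u v) = u.trace * v.trace := by
  rw [trace_mulLeftMulRight_matrix, Matrix.trace, Matrix.trace, Finset.sum_mul_sum]
  refine Finset.sum_congr rfl fun k _ => Finset.sum_congr rfl fun l _ => ?_
  have : mulLeftMulRight F (u k k) (v l l) = (u k k * v l l) • LinearMap.id := by
    ext; simp
  rw [this, map_smul, trace_id]
  simp

theorem trace_mulLeftMulRight_congr {E : Type*} [Ring E] [Algebra F E] (e : D ≃ₐ[F] E) (u v : D) :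
    trace F _ (mulLeftMulRight F (e u) (e v)) = trace F _ (mulLeftMulRight F u v) := by
  rw [← trace_conj' (mulLeftMulRight F u v) e.toLinearEquiv]
  congr 1
  ext a
  simp

end LinearMap

/-- If a scalar extension of `D` is a matrix algebra, the trace of `a ↦ u a v` is the product of
the traces of the matrices of `u` and `v`. -/
theorem algebraMap_trace_mulLeftMulRight {F D Ω ι : Type*} [Field F] [Ring D] [Algebra F D]
    [FiniteDimensional F D] [Field Ω] [Algebra F Ω] [Fintype ι] [DecidableEq ι]
    (e : Ω ⊗[F] D ≃ₐ[Ω] Matrix ι ι Ω) (u v : D) :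
    algebraMap F Ω (LinearMap.trace F D (LinearMap.mulLeftMulRight F u v)) =
      (e (1 ⊗ₜ u)).trace * (e (1 ⊗ₜ v)).trace := by
  rw [← LinearMap.trace_mulLeftMulRight_field_matrix, LinearMap.trace_mulLeftMulRight_congr,
    ← LinearMap.trace_baseChange]
  congr 1
  ext a
  simp

/-! ### Central division algebras -/

section CentralDivisionAlgebra

variable {F D : Type*} [Field F] [DivisionRing D] [Algebra F D] [FiniteDimensional F D]
  [Algebra.IsCentral F D]

attribute [local instance] TensorProduct.Algebra.module in
/-- Every `F`-linear endomorphism of a central division algebra is a sum of maps `x ↦ a x b`. -/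
theorem exists_sum_mul_mul_eq_of_isCentral (f : D →ₗ[F] D) :
    ∃ s : D ⊗[F] Dᵐᵒᵖ, ∀ x, f x = AlgHom.mulLeftRight F D s x := by
  -- Jacobson density for the bimodule `D`: it is simple and its endomorphisms are the scalars from
  -- `F`, so every `F`-linear map agrees with some `s` on a finite basis.
  have hsimple : IsSimpleModule (D ⊗[F] Dᵐᵒᵖ) D := by
    have : Nontrivial (Submodule (D ⊗[F] Dᵐᵒᵖ) D) := (Submodule.nontrivial_iff _).2 inferInstance
    refine { eq_bot_or_eq_top := fun N => ?_ }
    refine or_iff_not_imp_left.2 fun hN => ?_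
    obtain ⟨x, hx, hx0⟩ := N.ne_bot_iff.1 hN
    refine eq_top_iff.2 fun y _ => ?_
    have := N.smul_mem ((y * x⁻¹) ⊗ₜ 1) hx
    rwa [TensorProduct.Algebra.smul_def, one_smul, smul_eq_mul, inv_mul_cancel_right₀ hx0] at this
  have hEnd : ∀ g : Module.End (D ⊗[F] Dᵐᵒᵖ) D, ∃ c : F, ∀ x, g x = c • x := by
    intro g
    have h1 : ∀ x, g x = x * g 1 := fun x => by
      have := g.map_smul (x ⊗ₜ 1) 1
      simpa [TensorProduct.Algebra.smul_def] using this
    have h2 : ∀ x, g x = g 1 * x := fun x => by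
      have := g.map_smul (1 ⊗ₜ MulOpposite.op x) 1
      simpa [TensorProduct.Algebra.smul_def] using this
    have h3 : g 1 ∈ Subalgebra.center F D :=
      Subalgebra.mem_center_iff.2 fun x => by rw [← h1, h2]
    obtain ⟨c, hc⟩ := Algebra.mem_bot.1 (Algebra.IsCentral.out h3)
    exact ⟨c, fun x => by rw [h2, ← hc, Algebra.smul_def]⟩
  let f' : Module.End (Module.End (D ⊗[F] Dᵐᵒᵖ) D) D :=
    { toFun := f
      map_add' := map_add f
      map_smul' := fun g x => by
        obtain ⟨c, hc⟩ := hEnd g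
        simp [hc] }
  let b := Module.finBasis F D
  classical
  obtain ⟨s, hs⟩ := jacobson_density f' (Finset.univ.image b)
  refine ⟨s, fun x => ?_⟩
  suffices f = AlgHom.mulLeftRight F D s from congrArg (· x) this
  refine b.ext fun i => ?_
  exact hs (b i) (by simp)

/-- A two-sided ideal is stable under the base change of every `F`-linear map of `D`, these being
sums of two-sided multiplications. A coordinate form followed by `1` then extracts a nonzero
coordinate, which is a unit of `Ω`. -/
theorem isSimpleRing_tensorProduct_of_isCentral (Ω : Type*) [Field Ω] [Algebra F Ω] :
    IsSimpleRing (Ω ⊗[F] D) := by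
  have : Nontrivial (Ω ⊗[F] D) := inferInstance
  refine isSimpleRing_iff_isTwoSided_imp.2 ⟨inferInstance, fun I hI => ?_⟩
  refine or_iff_not_imp_left.2 fun hI0 => ?_
  obtain ⟨z, hz, hz0⟩ := I.ne_bot_iff.1 hI0
  have key : ∀ f : D →ₗ[F] D, f.baseChange Ω z ∈ I := by
    intro f
    obtain ⟨s, hs⟩ := exists_sum_mul_mul_eq_of_isCentral f
    obtain rfl : f = AlgHom.mulLeftRight F D s := LinearMap.ext hs
    clear hs
    induction s using TensorProduct.induction_on with
    | zero => simp
    | add s t h1 h2 =>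
      rw [map_add, LinearMap.baseChange_add]
      exact I.add_mem h1 h2
    | tmul p q =>
      have : ((AlgHom.mulLeftRight F D (p ⊗ₜ q) : D →ₗ[F] D).baseChange Ω) z =
          (1 ⊗ₜ p) * z * (1 ⊗ₜ q.unop) := by
        clear hz hz0
        induction z using TensorProduct.induction_on with
        | zero => simp
        | add s t h1 h2 => simp only [map_add, h1, h2, mul_add, add_mul]
        | tmul x y => simp [AlgHom.mulLeftRight_apply]
      rw [this]
      exact I.mul_mem_right _ (I.mul_mem_left _ hz)
  let b := Module.finBasis F D
  let B := Algebra.TensorProduct.basis Ω b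
  obtain ⟨i, hi⟩ : ∃ i, B.repr z i ≠ 0 := by
    by_contra! h
    exact hz0 (B.repr.map_eq_zero_iff.1 (Finsupp.ext h))
  have h := key ((b.coord i).smulRight 1)
  have h2 : ((b.coord i).smulRight (1 : D)).baseChange Ω z = B.repr z i ⊗ₜ 1 := by
    have : ((b.coord i).smulRight (1 : D)).baseChange Ω = (B.coord i).smulRight (1 : Ω ⊗[F] D) := by
      refine B.ext fun k => ?_
      classical
      simp [B, Finsupp.single_apply, Algebra.TensorProduct.one_def]
      split_ifs <;> simp
    rw [this]
    simp [Algebra.TensorProduct.one_def, TensorProduct.smul_tmul']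
  rw [h2] at h
  refine (Ideal.eq_top_iff_one I).2 ?_
  have := I.mul_mem_left ((B.repr z i)⁻¹ ⊗ₜ 1) h
  rwa [Algebra.TensorProduct.tmul_mul_tmul, inv_mul_cancel₀ hi, one_mul] at this

theorem exists_algEquiv_matrix_of_isCentral (Ω : Type*) [Field Ω] [Algebra F Ω] [IsAlgClosed Ω] :
    ∃ m : ℕ, Module.finrank F D = m ^ 2 ∧
      Nonempty (Ω ⊗[F] D ≃ₐ[Ω] Matrix (Fin m) (Fin m) Ω) := by
  have := isSimpleRing_tensorProduct_of_isCentral (F := F) (D := D) Ω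
  obtain ⟨m, _, ⟨e⟩⟩ := IsSimpleRing.exists_algEquiv_matrix_of_isAlgClosed Ω (Ω ⊗[F] D)
  refine ⟨m, ?_, ⟨e⟩⟩
  have := e.toLinearEquiv.finrank_eq
  rw [Module.finrank_baseChange, Module.finrank_matrix] at this
  simpa [sq] using this

end CentralDivisionAlgebra

/-- The reduced trace can be computed in any splitting. -/
theorem IsReducedTrace.algebraMap_eq {F D : Type*} [Field F] [Ring D] [Algebra F D] {w : D} {c : F}
    (h : IsReducedTrace F w c) {m : ℕ} (e : AlgebraicClosure F ⊗[F] D ≃ₐ[AlgebraicClosure F]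
      Matrix (Fin m) (Fin m) (AlgebraicClosure F)) :
    algebraMap F (AlgebraicClosure F) c = (e (1 ⊗ₜ w)).trace := by
  obtain ⟨k, e', h⟩ := h
  obtain rfl : k = m := by
    have := (e'.symm.trans e).toLinearEquiv.finrank_eq
    simpa [Module.finrank_matrix, ← sq] using this
  rw [← h, ← Matrix.trace_map (e'.symm.trans e) (e' (1 ⊗ₜ w))]
  simp

/-- Descent of the trace to `F` is an assumption, which excludes the default value `0`; it is
verified in `plancherel_of_algEquiv`. -/
theorem algebraMap_reducedTrace {F D : Type*} [Field F] [Ring D] [Algebra F D] {w : D}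
    {m : ℕ} (e : AlgebraicClosure F ⊗[F] D ≃ₐ[AlgebraicClosure F]
      Matrix (Fin m) (Fin m) (AlgebraicClosure F))
    (h : ∃ c, algebraMap F (AlgebraicClosure F) c = (e (1 ⊗ₜ w)).trace) :
    algebraMap F (AlgebraicClosure F) (reducedTrace F w) = (e (1 ⊗ₜ w)).trace := by
  have h' : ∃ c : F, IsReducedTrace F w c := h.imp fun c hc => ⟨m, e, hc.symm⟩
  rw [reducedTrace, dif_pos h']
  exact h'.choose_spec.algebraMap_eq e

instance {D : Type*} [DivisionRing D] : Algebra.IsCentral (Subring.center D) D where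
  out x hx := Algebra.mem_bot.2 ⟨⟨x, Subring.mem_center_iff.2 (Subalgebra.mem_center_iff.1 hx)⟩, rfl⟩

/-! ### Representations of a Galois extension that are stable under the Galois group -/

section GaloisRepresentation

variable {K L Ω V : Type*} [Field K] [Field L] [Algebra K L] [FiniteDimensional K L] [IsGalois K L]
  [Field Ω] [Algebra K Ω] [AddCommGroup V] [Module K V] [Module Ω V] [IsScalarTower K Ω V]

/-- The subspace of `V` on which `y` in `L` acts by the scalar `j y`. -/
def weightSpace (φ : L →ₐ[K] Module.End Ω V) (j : L →ₐ[K] Ω) : Submodule Ω V where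
  carrier := {v | ∀ y, φ y v = j y • v}
  add_mem' {v w} hv hw y := by rw [map_add, hv, hw, smul_add]
  zero_mem' y := by simp
  smul_mem' c v hv y := by rw [map_smul, hv, smul_comm]

/-- Independence: the weight spaces lie in eigenspaces of a primitive element for distinct
eigenvalues. Spanning: dual bases for the trace form provide projections onto them. -/
theorem isInternal_weightSpace (φ : L →ₐ[K] Module.End Ω V) (j : L →ₐ[K] Ω)
    [DecidableEq (L ≃ₐ[K] L)] :
    DirectSum.IsInternal fun s : L ≃ₐ[K] L => weightSpace φ (j.comp s.toAlgHom) := by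
  classical
  refine DirectSum.isInternal_submodule_of_iSupIndep_of_iSup_eq_top ?_ ?_
  · obtain ⟨α, hα⟩ := Field.exists_primitive_element K L
    have hinj : Function.Injective fun s : L ≃ₐ[K] L => j (s α) := fun s t h => by
      have h1 : s α = t α := j.injective h
      have h2 : IntermediateField.adjoin K {α} ≤
          IntermediateField.fixedField (Subgroup.zpowers (t⁻¹ * s)) := by
        rw [IntermediateField.adjoin_simple_le_iff, IntermediateField.mem_fixedField_iff]
        intro f hf
        have h3 : t⁻¹ * s ∈ MulAction.stabilizer (L ≃ₐ[K] L) α := by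
          rw [MulAction.mem_stabilizer_iff, mul_smul, AlgEquiv.smul_def s, h1, ← AlgEquiv.smul_def,
            inv_smul_smul]
        exact (Subgroup.zpowers_le.2 h3) hf
      refine (inv_mul_eq_one.1 (AlgEquiv.ext fun y => ?_)).symm
      have hy : y ∈ IntermediateField.adjoin K {α} := hα ▸ IntermediateField.mem_top
      exact (IntermediateField.mem_fixedField_iff _ _).1 (h2 hy) _ (Subgroup.mem_zpowers _)
    refine ((φ α).eigenspaces_iSupIndep.comp hinj).mono fun s v hv => ?_
    exact Module.End.mem_eigenspace_iff.2 (hv α)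
  · refine eq_top_iff.2 fun v _ => ?_
    let b := Module.finBasis K L
    have hb' : ∀ y, ∑ k, Algebra.trace K L (y * b k) • b.traceDual k = y := fun y => by
      conv_rhs => rw [← b.traceDual.sum_repr y]
      refine Finset.sum_congr rfl fun k _ => ?_
      rw [Module.Basis.traceDual_repr_apply, Algebra.traceForm_apply]
    have hb : ∀ y, ∑ k, Algebra.trace K L (y * b.traceDual k) • b k = y := fun y => by
      conv_rhs => rw [← b.sum_repr y]
      refine Finset.sum_congr rfl fun k _ => ?_
      congr 1
      conv_rhs => rw [← b.traceDual_traceDual]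
      rw [Module.Basis.traceDual_repr_apply, Algebra.traceForm_apply]
    -- `E s` is the image under `(j ∘ s) ⊗ φ` of the separability element `∑ k, b.traceDual k ⊗ b
    -- k`. Moving `y` across the tensor gives `φ y * E s = j (s y) • E s`; summing over `s` turns
    -- the dual basis into its traces, and `∑ s, E s = φ 1`.
    let E : (L ≃ₐ[K] L) → Module.End Ω V := fun s => ∑ k, j (s (b.traceDual k)) • φ (b k)
    have hK : ∀ (c : K) (f : Module.End Ω V), c • f = algebraMap K Ω c • f := fun c f =>
      (algebraMap_smul Ω c f).symm
    have hE : ∀ s, E s v ∈ weightSpace φ (j.comp s.toAlgHom) := fun s y => by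
      have h1 : φ y * E s = ∑ k, ∑ l, (algebraMap K Ω (Algebra.trace K L (y * b k * b.traceDual l)) *
          j (s (b.traceDual k))) • φ (b l) := by
        simp only [E, Finset.mul_sum]
        refine Finset.sum_congr rfl fun k _ => ?_
        rw [mul_smul_comm, ← map_mul]
        conv_lhs => rw [← hb (y * b k)]
        rw [map_sum, Finset.smul_sum]
        refine Finset.sum_congr rfl fun l _ => ?_
        rw [map_smul, hK, smul_smul, mul_comm]
      have h2 : j (s y) • E s = ∑ l, ∑ k, (algebraMap K Ω (Algebra.trace K L (y * b k *
          b.traceDual l)) * j (s (b.traceDual k))) • φ (b l) := by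
        simp only [E, Finset.smul_sum]
        refine Finset.sum_congr rfl fun l _ => ?_
        rw [smul_smul, ← map_mul, ← map_mul]
        conv_lhs => rw [← hb' (y * b.traceDual l)]
        rw [map_sum, map_sum, Finset.sum_smul]
        refine Finset.sum_congr rfl fun k _ => ?_
        rw [show y * b.traceDual l * b k = y * b k * b.traceDual l by ring, map_smul, map_smul,
          Algebra.smul_def (A := Ω)]
      rw [Finset.sum_comm, ← h2] at h1
      exact congrArg (· v) h1
    have hsum : ∑ s, E s v = v := by
      have : ∑ s, E s = 1 := by
        simp only [E]
        rw [Finset.sum_comm, ← map_one φ, ← hb 1, map_sum]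
        refine Finset.sum_congr rfl fun k _ => ?_
        rw [map_smul, hK, ← Finset.sum_smul, one_mul, ← map_sum,
          ← trace_eq_sum_automorphisms, AlgHom.commutes]
      rw [← LinearMap.sum_apply, this, Module.End.one_apply]
    rw [← hsum]
    exact Submodule.sum_mem _ fun s _ => Submodule.mem_iSup_of_mem s (hE s)

/-- A representation of `L` that is isomorphic to its conjugates under the Galois group contains
all the embeddings of `L` with the same multiplicity. -/
theorem exists_trace_eq_mul_trace_of_conj [FiniteDimensional Ω V] (φ : L →ₐ[K] Module.End Ω V)
    (j : L →ₐ[K] Ω)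
    (hφ : ∀ s : L ≃ₐ[K] L, ∃ u : Module.End Ω V, Function.Injective u ∧
      ∀ y, φ (s y) * u = u * φ y) :
    ∃ r : ℕ, Module.finrank Ω V = r * Module.finrank K L ∧
      ∀ y, LinearMap.trace Ω V (φ y) = r * algebraMap K Ω (Algebra.trace K L y) := by
  classical
  let N := fun s : L ≃ₐ[K] L => weightSpace φ (j.comp s.toAlgHom)
  -- An intertwiner for `s⁻¹ * t` embeds the weight space of `j ∘ t` into that of `j ∘ s`. As `s`
  -- and `t` are arbitrary, all weight spaces have the same dimension, which is `r`.
  have hle : ∀ t s, Module.finrank Ω (N t) ≤ Module.finrank Ω (N s) := fun t s => by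
    obtain ⟨u, hu, h⟩ := hφ (s⁻¹ * t)
    have hmap : ∀ v ∈ N t, u v ∈ N s := fun v hv y => by
      have := congrArg (· v) (h ((s⁻¹ * t)⁻¹ y))
      have hv' := hv ((s⁻¹ * t)⁻¹ y)
      simp only [Module.End.mul_apply, hv', map_smul] at this
      have e1 : (s⁻¹ * t) ((s⁻¹ * t)⁻¹ y) = y := AlgEquiv.apply_symm_apply _ y
      rw [e1] at this
      rw [this]
      congr 1
      change j (t ((s⁻¹ * t)⁻¹ y)) = j (s y)
      rw [← AlgEquiv.mul_apply, mul_inv_rev, inv_inv, mul_inv_cancel_left]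
    exact LinearMap.finrank_le_finrank_of_injective (f := u.restrict hmap) fun a b hab =>
      Subtype.ext (hu (congrArg Subtype.val hab))
  have hint := isInternal_weightSpace φ j
  have hcard : Fintype.card (L ≃ₐ[K] L) = Module.finrank K L := by
    rw [← IsGalois.card_aut_eq_finrank K L, Nat.card_eq_fintype_card]
  refine ⟨Module.finrank Ω (N 1), ?_, fun y => ?_⟩
  · have e := (LinearEquiv.ofBijective (DirectSum.coeLinearMap N) hint).finrank_eq
    rw [← e, Module.finrank_directSum, Finset.sum_congr rfl fun s _ => le_antisymm (hle s 1) (hle 1 s)]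
    simp [hcard, mul_comm]
  · have hmap : ∀ s, Set.MapsTo (φ y) (N s) (N s) := fun s v hv => by
      rw [SetLike.mem_coe, hv y]
      exact (N s).smul_mem _ hv
    have hy : algebraMap K Ω (Algebra.trace K L y) = ∑ s : L ≃ₐ[K] L, j (s y) := by
      rw [← map_sum, ← trace_eq_sum_automorphisms, AlgHom.commutes]
    rw [LinearMap.trace_eq_sum_trace_restrict hint hmap, hy, Finset.mul_sum]
    refine Finset.sum_congr rfl fun s _ => ?_
    have h1 : (φ y).restrict (hmap s) = j (s y) • LinearMap.id := by
      ext v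
      exact v.2 y
    change LinearMap.trace Ω (N s) ((φ y).restrict (hmap s)) = _
    rw [h1, map_smul, LinearMap.trace_id, le_antisymm (hle 1 s) (hle s 1), smul_eq_mul, mul_comm]

end GaloisRepresentation

/-! ### The trace form of a twisted group ring -/

namespace TwistedGroupRing

variable {L G : Type*} [Field L] [Group G] [MulSemiringAction Gᵐᵒᵖ L]

theorem ext_coeff {ξ η : TwistedGroupRing L G} (h : ∀ σ, coeff ξ σ = coeff η σ) : ξ = η :=
  (equivSkewMonoidAlgebra L G).injective <| MulOpposite.unop_injective <|
    SkewMonoidAlgebra.coeff_inj.1 <| Finsupp.ext fun σ => h σ.unop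

theorem single_add (σ : G) (y z : L) : single σ (y + z) = single σ y + single σ z := by
  classical
  refine ext_coeff fun τ => ?_
  rw [coeff_add, coeff_single, coeff_single, coeff_single]
  split_ifs <;> simp

theorem coeff_sum {ι : Type*} (s : Finset ι) (f : ι → TwistedGroupRing L G) (σ : G) :
    coeff (∑ i ∈ s, f i) σ = ∑ i ∈ s, coeff (f i) σ :=
  map_sum (AddMonoidHom.mk' (fun ξ => coeff ξ σ) fun ξ η => coeff_add ξ η σ) f s

variable [Fintype G]

theorem sum_single_coeff (ξ : TwistedGroupRing L G) : ∑ σ, single σ (coeff ξ σ) = ξ := by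
  classical
  refine ext_coeff fun τ => ?_
  simp [coeff_sum, coeff_single]

theorem coeff_single_mul (σ τ : G) (y : L) (ξ : TwistedGroupRing L G) :
    coeff (single σ y * ξ) (σ * τ) = MulOpposite.op τ • y * coeff ξ τ := by
  classical
  conv_lhs => rw [← sum_single_coeff ξ, Finset.mul_sum]
  simp [coeff_sum, coeff_single, single_mul_single]

variable (L G)

/-- The coefficients of the elements of `L ≀ G`, as a linear equivalence. -/
noncomputable def coeffEquiv : TwistedGroupRing L G ≃ₗ[fixedField L G] (G → L) where
  toFun := coeff
  map_add' ξ η := funext fun σ => coeff_add ξ η σ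
  map_smul' c ξ := rfl
  invFun f := ∑ σ, single σ (f σ)
  left_inv := sum_single_coeff
  right_inv f := by
    classical
    ext τ
    simp [coeff_sum, coeff_single]

instance : FiniteDimensional (fixedField L G) L :=
  have : Finite Gᵐᵒᵖ := Finite.of_equiv G MulOpposite.opEquiv
  inferInstance

instance : IsGalois (fixedField L G) L :=
  have : Finite Gᵐᵒᵖ := Finite.of_equiv G MulOpposite.opEquiv
  { to_isSeparable := inferInstance
    to_normal := inferInstance }

instance : Module.Finite (fixedField L G) (TwistedGroupRing L G) :=
  Module.Finite.equiv (coeffEquiv L G).symm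

variable {L G}

/-- Only pairs of inverse group elements contribute to the coefficient at `1`. This reduces the
bilinear formula to a linear one. -/
theorem form_eq_trace_coeff_mul (ξ η : TwistedGroupRing L G) :
    form L G ξ η = Algebra.trace (fixedField L G) L (coeff (ξ * η) 1) := by
  conv_rhs => rw [← sum_single_coeff ξ, Finset.sum_mul, coeff_sum, map_sum]
  rw [form_apply, ← Equiv.sum_comp (Equiv.inv G)]
  refine Finset.sum_congr rfl fun τ _ => ?_
  rw [Equiv.inv_apply, inv_inv, ← coeff_single_mul, mul_inv_cancel]

/-- Testing against `single τ⁻¹ z` isolates one coefficient of `ξ`, and the trace form of the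
separable extension `L/K` is nondegenerate. -/
theorem eq_zero_of_forall_trace_coeff_mul (ξ : TwistedGroupRing L G)
    (h : ∀ η, Algebra.trace (fixedField L G) L (coeff (ξ * η) 1) = 0) : ξ = 0 := by
  classical
  refine ext_coeff fun τ => ?_
  have h0 : coeff (0 : TwistedGroupRing L G) τ = 0 := congrFun (map_zero (coeffEquiv L G)) τ
  rw [h0]
  have h1 : MulOpposite.op τ⁻¹ • coeff ξ τ = 0 := by
    refine (traceForm_nondegenerate (fixedField L G) L).1 _ fun z => ?_
    have := h (single τ⁻¹ z)
    rw [← form_eq_trace_coeff_mul, form_apply, Finset.sum_eq_single τ⁻¹] at this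
    · simpa [coeff_single] using this
    · intro ρ _ hρ
      simp [coeff_single, Ne.symm hρ]
    · simp
  simpa using congrArg (MulOpposite.op τ • ·) h1

/-- `G` maps onto the Galois group of `L/K`, with all fibers of size `n`. -/
theorem sum_smul_eq_card_mul_trace (y : L) :
    ∑ σ : G, MulOpposite.op σ • y =
      Nat.card (actionKernel L G) * algebraMap (fixedField L G) L (Algebra.trace _ L y) := by
  classical
  let _ : Fintype Gᵐᵒᵖ := Fintype.ofEquiv G MulOpposite.opEquiv
  let f : Gᵐᵒᵖ →* (L ≃ₐ[fixedField L G] L) := MulSemiringAction.toAlgAut Gᵐᵒᵖ (fixedField L G) L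
  have hf : ∀ s, s ∈ Set.range f := FixedPoints.toAlgAut_surjective Gᵐᵒᵖ L
  have hcard : ∀ s, (Finset.univ.filter fun g => f g = s).card = Nat.card (actionKernel L G) := by
    intro s
    rw [MonoidHom.card_fiber_eq_of_mem_range f (hf s) (hf 1), Nat.card_eq_fintype_card,
      ← Fintype.card_coe]
    refine Fintype.card_congr ⟨fun g => ⟨g.1.unop, fun y => ?_⟩, fun g => ⟨MulOpposite.op g.1, ?_⟩,
      fun _ => rfl, fun _ => rfl⟩
    · exact DFunLike.congr_fun (Finset.mem_filter.1 g.2).2 y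
    · exact Finset.mem_filter.2 ⟨Finset.mem_univ _, AlgEquiv.ext g.2⟩
  have hop : ∑ σ : G, MulOpposite.op σ • y = ∑ g : Gᵐᵒᵖ, g • y :=
    Equiv.sum_comp MulOpposite.opEquiv fun g : Gᵐᵒᵖ => g • y
  rw [trace_eq_sum_automorphisms, Finset.mul_sum, hop,
    ← Finset.sum_fiberwise (Finset.univ : Finset Gᵐᵒᵖ) f]
  refine Finset.sum_congr rfl fun s _ => ?_
  rw [← hcard s, ← nsmul_eq_mul, ← Finset.sum_const]
  refine Finset.sum_congr rfl fun g hg => ?_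
  rw [← (Finset.mem_filter.1 hg).2]
  rfl

/-- The diagonal block at `σ` is multiplication by `y ^ σ * coeff ξ 1` on `L`; the sum over `σ`
produces the factor `n`. -/
theorem trace_mulLeftMulRight (y : L) (ξ : TwistedGroupRing L G) :
    LinearMap.trace (fixedField L G) _ (LinearMap.mulLeftMulRight _ (single 1 y) ξ) =
      Nat.card (actionKernel L G) * Algebra.trace (fixedField L G) L y *
        Algebra.trace (fixedField L G) L (coeff ξ 1) := by
  classical
  rw [← LinearMap.trace_conj' _ (coeffEquiv L G), LinearMap.trace_pi]
  have h : ∀ σ : G, LinearMap.proj σ ∘ₗ (coeffEquiv L G).conj (LinearMap.mulLeftMulRight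
      (fixedField L G) (single 1 y) ξ) ∘ₗ LinearMap.single (fixedField L G) (fun _ => L) σ =
      LinearMap.mulLeft (fixedField L G) (MulOpposite.op σ • y * coeff ξ 1) := by
    intro σ
    ext z
    have h1 : (coeffEquiv L G).symm (Pi.single σ z) = single σ z := by
      refine (coeffEquiv L G).symm_apply_eq.2 (funext fun τ => ?_)
      rw [show coeffEquiv L G (single σ z) τ = coeff (single σ z) τ from rfl, coeff_single,
        Pi.single_apply]
      exact if_congr eq_comm rfl rfl
    change coeff (single 1 y * ((coeffEquiv L G).symm (Pi.single σ z) * ξ)) σ = _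
    rw [h1, ← mul_assoc, single_mul_single, one_mul]
    have := coeff_single_mul σ 1 (MulOpposite.op σ • y * z) ξ
    rw [mul_one, MulOpposite.op_one, one_smul] at this
    rw [this, LinearMap.mulLeft_apply, mul_right_comm]
  simp only [h]
  have h2 : ∀ w : L, LinearMap.trace (fixedField L G) L (LinearMap.mulLeft (fixedField L G) w) =
      Algebra.trace (fixedField L G) L w := fun w => rfl
  simp only [h2]
  rw [← map_sum, ← Finset.sum_mul, sum_smul_eq_card_mul_trace]
  have : ((Nat.card (actionKernel L G) : L) * algebraMap (fixedField L G) L (Algebra.trace _ L y)) *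
      coeff ξ 1 = ((Nat.card (actionKernel L G) : fixedField L G) *
        Algebra.trace (fixedField L G) L y) • coeff ξ 1 := by
    rw [Algebra.smul_def, map_mul, map_natCast]
  rw [this, map_smul, smul_eq_mul]

/-- For `x` in the nilpotent radical, `x η` is nilpotent, and hence so is `a ↦ y a x η`, because
left and right multiplications commute. Its trace `n * Tr y * Tr (coeff (x η) 1)` vanishes; with `Tr
y = 1`, nondegeneracy gives `x = 0`. -/
theorem jacobson_op_eq_bot
    (hn : (Nat.card (actionKernel L G) : fixedField L G) ≠ 0) :
    Ring.jacobson (TwistedGroupRing L G)ᵐᵒᵖ = ⊥ := by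
  have : IsArtinianRing (TwistedGroupRing L G)ᵐᵒᵖ :=
    IsArtinianRing.of_finite (fixedField L G) _
  obtain ⟨k, hk⟩ := IsSemiprimaryRing.isNilpotent (R := (TwistedGroupRing L G)ᵐᵒᵖ)
  refine (Submodule.eq_bot_iff _).2 fun x hx => MulOpposite.unop_injective ?_
  refine eq_zero_of_forall_trace_coeff_mul _ fun η => ?_
  obtain ⟨y, hy⟩ := Algebra.trace_surjective (fixedField L G) L 1
  have h1 := trace_mulLeftMulRight y (x.unop * η)
  have hpow : (x.unop * η) ^ k = 0 := by
    have : MulOpposite.op η * x ∈ Ring.jacobson (TwistedGroupRing L G)ᵐᵒᵖ :=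
      Ideal.mul_mem_left _ _ hx
    have h2 := Ideal.pow_mem_pow this k
    rw [hk] at h2
    exact MulOpposite.op_injective h2
  have hnil : IsNilpotent (LinearMap.mulLeftMulRight (fixedField L G) (single 1 y) (x.unop * η)) := by
    refine (LinearMap.commute_mulLeft_right _ _).isNilpotent_mul_left ⟨k, ?_⟩
    rw [LinearMap.pow_mulRight, hpow, LinearMap.mulRight_zero_eq_zero]
  have h3 := (LinearMap.isNilpotent_trace_of_isNilpotent hnil).eq_zero
  rw [h1, hy, mul_one] at h3
  exact (mul_eq_zero.1 h3).resolve_left hn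

end TwistedGroupRing

/-! ### The matrices of the elements of an algebra on its simple modules -/

section RightMatrix

variable {K A X κ : Type*} [Field K] [Ring A] [Algebra K A] [AddCommGroup X] [Module Aᵐᵒᵖ X]
  [Module K X] [IsScalarTower K Aᵐᵒᵖ X] [Fintype κ] [DecidableEq κ]

/-- The matrix of the operation of `ξ` on the right module `X` over `A`, as an algebra
homomorphism. -/
noncomputable def rightMatrix (K : Type*) [Field K] [Algebra K A] [Module K X]
    [IsScalarTower K Aᵐᵒᵖ X] (b : Module.Basis κ (Module.End Aᵐᵒᵖ X) X) :
    A →ₐ[K] Matrix κ κ (Module.End Aᵐᵒᵖ X) :=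
  AlgHom.ofLinearMap
    { toFun := fun ξ => Matrix.of fun a c => b.repr (MulOpposite.op ξ • b a) c
      map_add' := fun ξ η => by ext1 a c; simp [add_smul]
      map_smul' := fun k ξ => by
        ext1 a c
        have h : MulOpposite.op (k • ξ) • b a =
            (k • (1 : Module.End Aᵐᵒᵖ X)) • (MulOpposite.op ξ • b a) := by
          rw [MulOpposite.op_smul, smul_assoc]
          rfl
        simp only [Matrix.of_apply, h, map_smul, Matrix.smul_apply, Finsupp.smul_apply,
          RingHom.id_apply, smul_eq_mul, smul_mul_assoc, one_mul] }
    (by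
      ext1 a c
      change b.repr (MulOpposite.op (1 : A) • b a) c = _
      rw [MulOpposite.op_one, one_smul, b.repr_self, Matrix.one_apply, Finsupp.single_apply])
    (fun ξ η => by
      ext1 a c
      change b.repr (MulOpposite.op (ξ * η) • b a) c = _
      -- Rows hold the coordinates of images and `A` acts from the right, so the order of products
      -- is preserved.
      have h : MulOpposite.op (ξ * η) • b a =
          ∑ e, b.repr (MulOpposite.op ξ • b a) e • (MulOpposite.op η • b e) := by
        rw [MulOpposite.op_mul, mul_smul]
        conv_lhs => rw [← b.sum_repr (MulOpposite.op ξ • b a), Finset.smul_sum]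
        exact Finset.sum_congr rfl fun e _ => (smul_comm _ _ _).symm
      rw [h, map_sum, Finsupp.finsetSum_apply, Matrix.mul_apply]
      exact Finset.sum_congr rfl fun e _ => by rw [map_smul]; rfl)

theorem rightMatrix_apply (b : Module.Basis κ (Module.End Aᵐᵒᵖ X) X) (ξ : A) (a c : κ) :
    rightMatrix K b ξ a c = b.repr (MulOpposite.op ξ • b a) c := rfl

theorem matrixTrace_rightOperation (b : Module.Basis κ (Module.End Aᵐᵒᵖ X) X) (ξ : A) :
    matrixTrace b (rightOperation A X ξ) = (rightMatrix K b ξ).trace := rfl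

end RightMatrix

section Wedderburn

variable {K A ι : Type*} [Field K] [Ring A] [Algebra K A] {X : ι → Type*}
  [∀ i, AddCommGroup (X i)] [∀ i, Module Aᵐᵒᵖ (X i)] [∀ i, Module K (X i)]
  [∀ i, IsScalarTower K Aᵐᵒᵖ (X i)] [∀ i, IsSimpleModule Aᵐᵒᵖ (X i)]
  {κ : ι → Type*} [∀ i, Fintype (κ i)] [∀ i, DecidableEq (κ i)]

/-- The operation of `A` on a finite family of pairwise nonisomorphic simple modules is
surjective. -/
theorem exists_forall_rightMatrix_eq [Finite ι]
    (hinj : ∀ i j, Nonempty (X i ≃ₗ[Aᵐᵒᵖ] X j) → i = j)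
    (b : ∀ i, Module.Basis (κ i) (Module.End Aᵐᵒᵖ (X i)) (X i))
    (M : ∀ i, Matrix (κ i) (κ i) (Module.End Aᵐᵒᵖ (X i))) :
    ∃ ξ : A, ∀ i, rightMatrix K (b i) ξ = M i := by
  classical
  have := Fintype.ofFinite ι
  let f : ∀ i, X i →ₗ[Module.End Aᵐᵒᵖ (X i)] X i :=
    fun i => (b i).constr ℕ fun a => ∑ c, M i a c • b i c
  -- By Schur's lemma there are no nonzero maps between different `X i`, so every endomorphism of
  -- the product is diagonal and commutes with `F`. Density can then be applied to all the basis
  -- vectors at once.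
  have hdiag : ∀ (g : Module.End Aᵐᵒᵖ (∀ i, X i)) (v : ∀ i, X i) (j : ι),
      g v j = g (Pi.single j (v j)) j := by
    intro g v j
    conv_lhs => rw [← Finset.univ_sum_single v, map_sum, Finset.sum_apply]
    refine Finset.sum_eq_single j (fun i _ hij => ?_) (by simp)
    let gij : X i →ₗ[Aᵐᵒᵖ] X j := LinearMap.proj j ∘ₗ g ∘ₗ LinearMap.single Aᵐᵒᵖ X i
    rcases gij.bijective_or_eq_zero with h | h
    · exact absurd (hinj i j ⟨LinearEquiv.ofBijective gij h⟩) hij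
    · exact DFunLike.congr_fun h (v i)
  let F : Module.End (Module.End Aᵐᵒᵖ (∀ i, X i)) (∀ i, X i) :=
    { toFun := fun v i => f i (v i)
      map_add' := fun v w => funext fun i => map_add (f i) _ _
      map_smul' := fun g v => funext fun j => by
        let gj : Module.End Aᵐᵒᵖ (X j) := LinearMap.proj j ∘ₗ g ∘ₗ LinearMap.single Aᵐᵒᵖ X j
        have h := (f j).map_smul gj (v j)
        change f j (g v j) = g (fun i => f i (v i)) j
        rw [hdiag g v j, hdiag g (fun i => f i (v i)) j]
        exact h }
  obtain ⟨r, hr⟩ := jacobson_density F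
    (Finset.univ.image fun p : Σ i, κ i => Pi.single p.1 (b p.1 p.2))
  refine ⟨r.unop, fun i => ?_⟩
  ext1 a c
  have h := congrFun (hr (Pi.single i (b i a)) (Finset.mem_image_of_mem _ (Finset.mem_univ
    (⟨i, a⟩ : Σ i, κ i)))) i
  change f i (Pi.single i (b i a) i) = r • (Pi.single i (b i a) : ∀ i, X i) i at h
  rw [Pi.single_eq_same, Module.Basis.constr_basis] at h
  rw [rightMatrix_apply, MulOpposite.op_unop, ← h, Module.Basis.repr_sum_self]

/-- Such a `ξ` annihilates every simple module, in particular each quotient of `Aᵐᵒᵖ` by a maximal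
left ideal, so it lies in the Jacobson radical. -/
theorem rightMatrix_injective {A : Type u} [Ring A] [Algebra K A] {X : ι → Type*}
    [∀ i, AddCommGroup (X i)] [∀ i, Module Aᵐᵒᵖ (X i)] [∀ i, Module K (X i)]
    [∀ i, IsScalarTower K Aᵐᵒᵖ (X i)]
    (hcomplete : ∀ (Y : Type u) [AddCommGroup Y] [Module Aᵐᵒᵖ Y],
      IsSimpleModule Aᵐᵒᵖ Y → ∃ i, Nonempty (Y ≃ₗ[Aᵐᵒᵖ] X i))
    (hjac : Ring.jacobson Aᵐᵒᵖ = ⊥)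
    (b : ∀ i, Module.Basis (κ i) (Module.End Aᵐᵒᵖ (X i)) (X i))
    {ξ : A} (hξ : ∀ i, rightMatrix K (b i) ξ = 0) : ξ = 0 := by
  have h0 : ∀ i (x : X i), MulOpposite.op ξ • x = 0 := by
    intro i x
    have h1 : ∀ a, MulOpposite.op ξ • b i a = 0 := fun a => by
      rw [← (b i).repr.map_eq_zero_iff]
      ext1 c
      rw [← rightMatrix_apply (K := K), hξ]
      rfl
    rw [← (b i).sum_repr x, Finset.smul_sum]
    exact Finset.sum_eq_zero fun a _ => by rw [smul_comm, h1, smul_zero]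
  suffices MulOpposite.op ξ ∈ Ring.jacobson Aᵐᵒᵖ by
    rw [hjac] at this
    exact MulOpposite.op_injective this
  rw [Ring.jacobson_eq_sInf_isMaximal]
  refine Submodule.mem_sInf.2 fun I hI => ?_
  have : IsSimpleModule Aᵐᵒᵖ (Aᵐᵒᵖ ⧸ I) := isSimpleModule_iff_isCoatom.2 (Ideal.isMaximal_def.1 hI)
  obtain ⟨i, ⟨e⟩⟩ := hcomplete (Aᵐᵒᵖ ⧸ I) this
  have h2 : MulOpposite.op ξ • (Submodule.Quotient.mk 1 : Aᵐᵒᵖ ⧸ I) = 0 :=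
    e.injective (by rw [map_smul, h0, map_zero])
  rw [← Submodule.Quotient.mk_smul, smul_eq_mul, mul_one, Submodule.Quotient.mk_eq_zero] at h2
  exact h2

end Wedderburn

/-! ### Matrices over a division algebra -/

section DivisionAlgebra

variable (K D : Type*) [Field K] [DivisionRing D] [Algebra K D]

/-- The center of a division algebra as an algebra over the base field. -/
noncomputable abbrev centerAlgebra : Algebra K (Subring.center D) :=
  ((algebraMap K D).codRestrict (Subring.center D) fun k =>
    Subring.mem_center_iff.2 fun x => (Algebra.commutes k x).symm).toAlgebra

attribute [local instance] centerAlgebra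

instance isScalarTower_center : IsScalarTower K (Subring.center D) D :=
  IsScalarTower.of_algebraMap_eq fun _ => rfl

theorem skewFieldTrace_eq (w : D) :
    skewFieldTrace K w = Algebra.trace K (Subring.center D) (reducedTrace (Subring.center D) w) := by
  let e : Subring.center D ≃ₐ[K] Subalgebra.center K D :=
    { toFun := fun z => ⟨z, z.2⟩
      invFun := fun z => ⟨z, z.2⟩
      left_inv := fun _ => rfl
      right_inv := fun _ => rfl
      map_mul' := fun _ _ => rfl
      map_add' := fun _ _ => rfl
      commutes' := fun _ => rfl }
  exact Algebra.trace_eq_of_algEquiv e _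

theorem finite_center [FiniteDimensional K D] : FiniteDimensional K (Subring.center D) :=
  Module.Finite.of_injective
    ((IsScalarTower.toAlgHom K (Subring.center D) D).toLinearMap) Subtype.val_injective

theorem finite_over_center (K D : Type*) [Field K] [DivisionRing D] [Algebra K D]
    [FiniteDimensional K D] : FiniteDimensional (Subring.center D) D :=
  Module.Finite.of_restrictScalars_finite K (Subring.center D) D

variable {K D}
variable {κ : Type*} [Fintype κ] [DecidableEq κ]

/-- A splitting of the central division algebra `D` over `Z` gives a representation of the matrix
algebras over `D` by matrices over the algebraic closure of `Z`. -/
noncomputable def splitMatrix {d : ℕ}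
    (e : AlgebraicClosure (Subring.center D) ⊗[Subring.center D] D
      ≃ₐ[AlgebraicClosure (Subring.center D)]
        Matrix (Fin d) (Fin d) (AlgebraicClosure (Subring.center D))) :
    Matrix κ κ D →ₐ[Subring.center D]
      Matrix (κ × Fin d) (κ × Fin d) (AlgebraicClosure (Subring.center D)) :=
  (Matrix.compAlgEquiv κ (Fin d) (AlgebraicClosure (Subring.center D))
    (Subring.center D)).toAlgHom.comp
    (AlgHom.mapMatrix ((e.toAlgHom.restrictScalars (Subring.center D)).comp
      Algebra.TensorProduct.includeRight))

theorem trace_splitMatrix {d : ℕ}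
    (e : AlgebraicClosure (Subring.center D) ⊗[Subring.center D] D
      ≃ₐ[AlgebraicClosure (Subring.center D)]
        Matrix (Fin d) (Fin d) (AlgebraicClosure (Subring.center D))) (M : Matrix κ κ D) :
    (splitMatrix e M).trace = ∑ k, (e (1 ⊗ₜ M k k)).trace := by
  rw [Matrix.trace, Fintype.sum_prod_type]
  rfl

/-- The witness `t` is the trace over the center, and transitivity of the trace passes to `K`. Here
only the product of the two split traces is known to lie in the center, not each factor. -/
theorem trace_mulLeftMulRight_matrix_divisionRing [FiniteDimensional K D] {d : ℕ}
    (e : AlgebraicClosure (Subring.center D) ⊗[Subring.center D] D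
      ≃ₐ[AlgebraicClosure (Subring.center D)]
        Matrix (Fin d) (Fin d) (AlgebraicClosure (Subring.center D))) (u v : Matrix κ κ D) :
    ∃ t : Subring.center D,
      algebraMap _ (AlgebraicClosure (Subring.center D)) t =
        (splitMatrix e u).trace * (splitMatrix e v).trace ∧
      LinearMap.trace K _ (LinearMap.mulLeftMulRight K u v) =
        Algebra.trace K (Subring.center D) t := by
  have := finite_center K D
  have := finite_over_center K D
  refine ⟨∑ k, ∑ l, LinearMap.trace (Subring.center D) D
    (LinearMap.mulLeftMulRight (Subring.center D) (u k k) (v l l)), ?_, ?_⟩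
  · rw [trace_splitMatrix, trace_splitMatrix, Finset.sum_mul_sum, map_sum]
    refine Finset.sum_congr rfl fun k _ => ?_
    rw [map_sum]
    exact Finset.sum_congr rfl fun l _ => algebraMap_trace_mulLeftMulRight e _ _
  · rw [LinearMap.trace_mulLeftMulRight_matrix, map_sum]
    refine Finset.sum_congr rfl fun k _ => ?_
    rw [map_sum]
    refine Finset.sum_congr rfl fun l _ => ?_
    rw [← LinearMap.trace_trace_restrictScalars]
    rfl

end DivisionAlgebra

/-! ### The Plancherel formula -/

namespace TwistedGroupRing

attribute [local instance] centerAlgebra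

variable {L G : Type*} [Field L] [Group G] [Fintype G] [MulSemiringAction Gᵐᵒᵖ L]

variable (L G) in
/-- The inclusion of `L` in `L ≀ G`. -/
noncomputable def inclusion : L →ₐ[fixedField L G] TwistedGroupRing L G :=
  AlgHom.mk
    { toFun := single 1
      map_one' := rfl
      map_mul' := fun y z => by
        rw [single_mul_single, mul_one, MulOpposite.op_one, one_smul]
      map_zero' := by
        have := single_add (1 : G) (0 : L) 0
        rwa [add_zero, left_eq_add] at this
      map_add' := single_add 1 } fun _ => rfl

/-- The units `single σ 1` conjugate `L` through its Galois group, so the split representation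
restricted to `L` is isomorphic to all its conjugates. -/
theorem exists_trace_splitMatrix_eq {D κ : Type*} [DivisionRing D] [Algebra (fixedField L G) D]
    [Fintype κ] [DecidableEq κ] {d : ℕ}
    (e : AlgebraicClosure (Subring.center D) ⊗[Subring.center D] D
      ≃ₐ[AlgebraicClosure (Subring.center D)]
        Matrix (Fin d) (Fin d) (AlgebraicClosure (Subring.center D)))
    (R : TwistedGroupRing L G →ₐ[fixedField L G] Matrix κ κ D) :
    ∃ r : ℕ, Fintype.card κ * d = r * Module.finrank (fixedField L G) L ∧
      ∀ y, (splitMatrix e (R (single 1 y))).trace =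
        r * algebraMap (Subring.center D) (AlgebraicClosure (Subring.center D))
          (algebraMap (fixedField L G) (Subring.center D)
            (Algebra.trace (fixedField L G) L y)) := by
  let Ω := AlgebraicClosure (Subring.center D)
  let Φ : TwistedGroupRing L G →ₐ[fixedField L G] Module.End Ω (κ × Fin d → Ω) :=
    (((Matrix.toLinAlgEquiv' : Matrix (κ × Fin d) (κ × Fin d) Ω ≃ₐ[Ω] _).toAlgHom.restrictScalars
      (fixedField L G)).comp ((splitMatrix e).restrictScalars (fixedField L G))).comp R
  have hΦ : ∀ ξ, Φ ξ = Matrix.toLin' (splitMatrix e (R ξ)) := fun ξ => rfl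
  have : Normal (fixedField L G) L := inferInstance
  let j : L →ₐ[fixedField L G] Ω := IsAlgClosed.lift
  obtain ⟨r, hr, h⟩ := exists_trace_eq_mul_trace_of_conj (Φ.comp (inclusion L G)) j fun s => by
    have : Finite Gᵐᵒᵖ := Finite.of_equiv G MulOpposite.opEquiv
    -- Moving `s y` past `single σ 1` applies `σ` to it, so `σ` has to act as `s⁻¹`.
    obtain ⟨σ, hσ⟩ := FixedPoints.toAlgAut_surjective Gᵐᵒᵖ L s⁻¹
    have hinv : single σ.unop⁻¹ (1 : L) * single σ.unop 1 = 1 := by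
      rw [single_mul_single, inv_mul_cancel, smul_one, mul_one]
      rfl
    refine ⟨Φ (single σ.unop 1), ?_, fun y => ?_⟩
    · refine Function.LeftInverse.injective (g := Φ (single σ.unop⁻¹ 1)) fun v => ?_
      rw [← Module.End.mul_apply, ← map_mul, hinv, map_one, Module.End.one_apply]
    · have hy : σ • s y = y := by
        have := DFunLike.congr_fun hσ (s y)
        exact this.trans (s.symm_apply_apply y)
      have : single 1 (s y) * single σ.unop (1 : L) = single σ.unop 1 * single 1 y := by
        rw [single_mul_single, single_mul_single, one_mul, mul_one, mul_one, smul_one, one_mul,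
          MulOpposite.op_unop, hy]
      change Φ (single 1 (s y)) * _ = _ * Φ (single 1 y)
      rw [← map_mul, this, map_mul]
  refine ⟨r, ?_, fun y => ?_⟩
  · rw [← hr, Module.finrank_fintype_fun_eq_card, Fintype.card_prod, Fintype.card_fin]
  · rw [← Matrix.trace_toLin'_eq, ← hΦ, ← IsScalarTower.algebraMap_apply]
    exact h y

theorem plancherel_of_algEquiv
    (hn : (Nat.card (actionKernel L G) : fixedField L G) ≠ 0)
    {ι : Type*} [Fintype ι] {D κ : ι → Type*} [∀ i, DivisionRing (D i)]
    [∀ i, Algebra (fixedField L G) (D i)] [∀ i, FiniteDimensional (fixedField L G) (D i)]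
    [∀ i, Fintype (κ i)] [∀ i, DecidableEq (κ i)] [∀ i, Nonempty (κ i)]
    (R : TwistedGroupRing L G ≃ₐ[fixedField L G] ∀ i, Matrix (κ i) (κ i) (D i)) :
    (∀ i, skewFieldIndex (D i) ^ 2 = Module.finrank (Subring.center (D i)) (D i)) ∧
    (∀ i, Module.finrank (fixedField L G) L ∣ Fintype.card (κ i) * skewFieldIndex (D i)) ∧
    ∀ ξ, Algebra.trace (fixedField L G) L (coeff ξ 1) =
      ∑ i, ((Fintype.card (κ i) * skewFieldIndex (D i) / Module.finrank (fixedField L G) L : ℕ) :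
        fixedField L G) / Nat.card (actionKernel L G) *
          skewFieldTrace (fixedField L G) (R ξ i).trace := by
  classical
  have hfd : ∀ i, FiniteDimensional (Subring.center (D i)) (D i) :=
    fun i => finite_over_center (fixedField L G) (D i)
  choose d hd e using fun i => exists_algEquiv_matrix_of_isCentral (F := Subring.center (D i))
    (D := D i) (AlgebraicClosure (Subring.center (D i)))
  have e := fun i => (e i).some
  have hindex : ∀ i, skewFieldIndex (D i) = d i := fun i => by
    rw [skewFieldIndex, hd, Nat.sqrt_eq']
  choose r hr htr using fun i => exists_trace_splitMatrix_eq (e i)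
    ((Pi.evalAlgHom (fixedField L G) _ i).comp R.toAlgHom)
  refine ⟨fun i => by rw [hindex, hd], fun i => ?_, ?_⟩
  · rw [hindex, hr]
    exact dvd_mul_left _ _
  obtain ⟨y, hy⟩ := Algebra.trace_surjective (fixedField L G) L 1
  have hry : ∀ i, (splitMatrix (e i) (R (single 1 y) i)).trace =
      algebraMap (Subring.center (D i)) _ (r i : Subring.center (D i)) := fun i => by
    have := htr i y
    rw [hy, map_one, map_one, mul_one] at this
    rw [map_natCast]
    exact this
  -- `T i M` is a central element whose image in the algebraic closure is `r i` times the split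
  -- trace of `M`.
  choose T hT hT' using fun i (M : Matrix (κ i) (κ i) (D i)) =>
    trace_mulLeftMulRight_matrix_divisionRing (K := fixedField L G) (e i) (R (single 1 y) i) M
  simp only [hry] at hT
  have key : ∀ ξ, (Nat.card (actionKernel L G) : fixedField L G) *
      Algebra.trace (fixedField L G) L (coeff ξ 1) =
      ∑ i, Algebra.trace (fixedField L G) (Subring.center (D i)) (T i (R ξ i)) := fun ξ => by
    have := trace_mulLeftMulRight y ξ
    rw [hy, mul_one] at this
    rw [← this, ← LinearMap.trace_mulLeftMulRight_congr R, LinearMap.trace_mulLeftMulRight_pi]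
    exact Finset.sum_congr rfl fun i _ => hT' i _
  have hT0 : ∀ i, T i 0 = 0 := fun i => by
    refine (algebraMap _ (AlgebraicClosure (Subring.center (D i)))).injective ?_
    rw [hT, map_zero, Matrix.trace_zero, mul_zero, map_zero]
  -- The characteristic could a priori divide `r i`. Then `T i` would vanish, and the central
  -- idempotent of block `i` would lie in the radical of the nondegenerate form.
  have hr0 : ∀ i, (r i : Subring.center (D i)) ≠ 0 := fun i hi => by
    have hTi : ∀ M, T i M = 0 := fun M => by
      refine (algebraMap _ (AlgebraicClosure (Subring.center (D i)))).injective ?_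
      rw [hT, hi, map_zero, zero_mul]
    have h0 : R.symm (Pi.single i 1) = 0 := by
      refine eq_zero_of_forall_trace_coeff_mul _ fun η => ?_
      have h := key (R.symm (Pi.single i 1) * η)
      rw [Finset.sum_eq_zero, mul_eq_zero] at h
      · exact h.resolve_left hn
      · intro k _
        rw [map_mul, AlgEquiv.apply_symm_apply, Pi.mul_apply]
        by_cases hk : k = i
        · subst hk
          rw [hTi, map_zero]
        · rw [Pi.single_eq_of_ne hk, zero_mul, hT0, map_zero]
    have h1 : (Pi.single i 1 : ∀ i, Matrix (κ i) (κ i) (D i)) = 0 := by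
      rw [← R.apply_symm_apply (Pi.single i 1), h0, map_zero]
    have h2 := congrFun h1 i
    rw [Pi.single_eq_same] at h2
    exact one_ne_zero h2
  have hred : ∀ i (w : D i), algebraMap _ (AlgebraicClosure (Subring.center (D i)))
      (reducedTrace (Subring.center (D i)) w) = (e i (1 ⊗ₜ w)).trace := fun i w => by
    refine algebraMap_reducedTrace (e i) ?_
    let k := Classical.arbitrary (κ i)
    -- Since `r i` is invertible in the center, the split trace of `w` descends to it.
    refine ⟨(r i : Subring.center (D i))⁻¹ * T i (Matrix.single k k w), ?_⟩
    rw [map_mul, hT, ← mul_assoc, ← map_mul, inv_mul_cancel₀ (hr0 i), map_one, one_mul,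
      trace_splitMatrix, Finset.sum_eq_single k]
    · rw [Matrix.single_apply_same]
    · intro l _ hl
      rw [Matrix.single_apply_of_ne _ _ _ _ _ (by simp [Ne.symm hl]), TensorProduct.tmul_zero,
        map_zero, Matrix.trace_zero]
    · simp
  have hTred : ∀ i M, T i M = r i • reducedTrace (Subring.center (D i)) M.trace := fun i M => by
    refine (algebraMap _ (AlgebraicClosure (Subring.center (D i)))).injective ?_
    rw [hT, nsmul_eq_mul, map_mul, hred, trace_splitMatrix, show M.trace = ∑ k, M k k from rfl,
      TensorProduct.tmul_sum, map_sum, Matrix.trace_sum]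
  intro ξ
  refine mul_left_cancel₀ hn ((key ξ).trans ?_)
  rw [Finset.mul_sum]
  refine Finset.sum_congr rfl fun i _ => ?_
  rw [hTred, map_nsmul, ← skewFieldTrace_eq, hindex, hr,
    Nat.mul_div_cancel _ Module.finrank_pos, nsmul_eq_mul, ← mul_assoc, mul_div_cancel₀ _ hn]

end TwistedGroupRing

/-! ### Finiteness of simple modules and their endomorphism rings -/

section SimpleModule

theorem finiteDimensional_of_isSimpleModule (K A X : Type*) [Field K] [Ring A] [Algebra K A]
    [FiniteDimensional K A] [AddCommGroup X] [Module Aᵐᵒᵖ X] [Module K X] [IsScalarTower K Aᵐᵒᵖ X]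
    [IsSimpleModule Aᵐᵒᵖ X] : FiniteDimensional K X :=
  have : Module.Finite K Aᵐᵒᵖ := Module.Finite.equiv (MulOpposite.opLinearEquiv K)
  Module.Finite.trans Aᵐᵒᵖ X

theorem finiteDimensional_end (K A X : Type*) [Field K] [Ring A] [Algebra K A]
    [AddCommGroup X] [Module A X] [Module K X] [IsScalarTower K A X] [FiniteDimensional K X] :
    FiniteDimensional K (Module.End A X) :=
  Module.Finite.of_injective
    ({ toFun := fun f => f.restrictScalars K
       map_add' := fun _ _ => rfl
       map_smul' := fun _ _ => rfl } : Module.End A X →ₗ[K] X →ₗ[K] X)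
    fun _ _ h => LinearMap.ext fun x => DFunLike.congr_fun h x

end SimpleModule

theorem mainTheorem5
    {L : Type u} {G : Type v} [Field L] [Group G] [Fintype G] [MulSemiringAction Gᵐᵒᵖ L]
    -- `n = |N|` is invertible in `K`
    (hn : (Nat.card (TwistedGroupRing.actionKernel L G) : TwistedGroupRing.fixedField L G) ≠ 0)
    -- `X i` are right `L ≀ G`-modules; the `K`-module structures are the restricted ones
    {ι : Type*} [Fintype ι] (X : ι → Type w) [∀ i, AddCommGroup (X i)]
    [∀ i, Module (TwistedGroupRing L G)ᵐᵒᵖ (X i)]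
    [∀ i, Module (TwistedGroupRing.fixedField L G) (X i)]
    [∀ i, IsScalarTower (TwistedGroupRing.fixedField L G) (TwistedGroupRing L G)ᵐᵒᵖ (X i)]
    -- they form a complete set of nonisomorphic simple modules
    [∀ i, IsSimpleModule (TwistedGroupRing L G)ᵐᵒᵖ (X i)]
    (hinj : ∀ i j, Nonempty (X i ≃ₗ[(TwistedGroupRing L G)ᵐᵒᵖ] X j) → i = j)
    (hcomplete : ∀ (Y : Type (max u v)) [AddCommGroup Y] [Module (TwistedGroupRing L G)ᵐᵒᵖ Y],
      IsSimpleModule (TwistedGroupRing L G)ᵐᵒᵖ Y →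
        ∃ i, Nonempty (Y ≃ₗ[(TwistedGroupRing L G)ᵐᵒᵖ] X i)) :
    let D := fun i => Module.End (TwistedGroupRing L G)ᵐᵒᵖ (X i)
    let n : ℕ := Nat.card (TwistedGroupRing.actionKernel L G)
    let h : ℕ := Module.finrank (TwistedGroupRing.fixedField L G) L
    let x : ι → ℕ := fun i => Module.finrank (D i) (X i)
    let d : ι → ℕ := fun i => skewFieldIndex (D i)
    -- the degrees `x i` and `d i ^ 2` are finite, and `d i` is an integer
    (∀ i, Module.Finite (D i) (X i) ∧ Module.Finite (Subring.center (D i)) (D i) ∧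
      d i ^ 2 = Module.finrank (Subring.center (D i)) (D i)) ∧
    -- `x i * d i / h` is an integer
    (∀ i, h ∣ x i * d i) ∧
    -- the Plancherel formula, with `x i * d i / g = (x i * d i / h) / n`, as `g = n * h`
    ∀ (b : ∀ i, Module.Basis (Fin (x i)) (D i) (X i)) (ξ η : TwistedGroupRing L G),
      TwistedGroupRing.form L G ξ η =
        ∑ i, ((x i * d i / h : ℕ) : TwistedGroupRing.fixedField L G) / n *
          endTrace (TwistedGroupRing L G) (X i) (TwistedGroupRing.fixedField L G)
            (matrixTrace (b i) (rightOperation (TwistedGroupRing L G) (X i) ξ *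
              rightOperation (TwistedGroupRing L G) (X i) η)) := by

  classical
  intro D n h x d
  have hK : ∀ i, FiniteDimensional (TwistedGroupRing.fixedField L G) (X i) := fun i =>
    finiteDimensional_of_isSimpleModule _ (TwistedGroupRing L G) (X i)
  have hX : ∀ i, Module.Finite (D i) (X i) := fun i =>
    Module.Finite.of_restrictScalars_finite (TwistedGroupRing.fixedField L G) _ _
  have hD : ∀ i, FiniteDimensional (TwistedGroupRing.fixedField L G) (D i) := fun i =>
    finiteDimensional_end _ _ (X i)
  let _ : ∀ i, DivisionRing (D i) := fun i => Module.End.instDivisionRing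
  have hκ : ∀ i, Nonempty (Fin (x i)) := fun i => by
    have : Nontrivial (X i) := IsSimpleModule.nontrivial (TwistedGroupRing L G)ᵐᵒᵖ (X i)
    exact ⟨⟨0, Module.finrank_pos⟩⟩
  -- The Wedderburn isomorphism depends on the bases, but the degrees and indices do not; any choice
  -- of bases therefore yields the assertions about them.
  have main := fun b : ∀ i, Module.Basis (Fin (x i)) (D i) (X i) =>
    TwistedGroupRing.plancherel_of_algEquiv hn (AlgEquiv.ofBijective
      (AlgHom.pi fun i => rightMatrix (TwistedGroupRing.fixedField L G) (b i))
      ⟨(injective_iff_map_eq_zero _).2 fun ξ hξ => rightMatrix_injective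
          (K := TwistedGroupRing.fixedField L G) hcomplete
          (TwistedGroupRing.jacobson_op_eq_bot hn) b fun i => congrFun hξ i,
        fun M => (exists_forall_rightMatrix_eq (K := TwistedGroupRing.fixedField L G) hinj b M).imp
          fun ξ hξ => funext hξ⟩)
  simp only [Fintype.card_fin] at main
  have hb := main fun i => Module.finBasis (D i) (X i)
  refine ⟨fun i => ⟨hX i, finite_over_center (TwistedGroupRing.fixedField L G) (D i), hb.1 i⟩,
    hb.2.1, fun b ξ η => ?_⟩
  rw [TwistedGroupRing.form_eq_trace_coeff_mul, (main b).2.2]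
  refine Finset.sum_congr rfl fun i _ => ?_
  rw [← map_mul, matrixTrace_rightOperation (K := TwistedGroupRing.fixedField L G)]
  rfl
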